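/- All semigroups and partial groupoids are non-empty. A partial groupoid is a set with a partial binary operation. $\mathrm{FO}[\cdot]$ denotes first-order logic (with equality) over finite partial groupoids whose only predicate is the ternary relation $xy=z$ (the product of $x$ and $y$ is defined and equals $z$). A class $\mathbf{C}$ of finite semigroups is $\mathrm{FO}[\cdot]$-definable if there is an $\mathrm{FO}[\cdot]$-sentence $\varphi$ such that, for every finite partial groupoid $G$, $G\models\varphi$ if and only if $G$ is a semigroup belonging to $\mathbf{C}$. A pseudovariety is a non-empty class of finite semigroups closed under finite direct products, subsemigroups and quotients (homomorphic images). Write $E(S)$ for the set of idempotents of $S$, and let - $\mathbf{K}$ be the class of finite semigroups $S$ with $xe=e$ for all $e\in E(S)$, $x\in S$; - $\mathbf{D}$ be the class of finite semigroups $S$ with $ex=e$ for all $e\in E(S)$, $x\in S$; - $\mathbf{N}$ be the class of finite semigroups all of whose idempotents are zero elements; - $\mathbb{L}\mathbf{I}$ (respectively $\mathbb{L}\mathbf{G}$) be the class of finite semigroups $S$ such that for every $e\in E(S)$ the monoid $eSe$ is trivial (respectively a group). A relational morphism $\tau$ from $S$ to $T$ is a relation $\tau\subseteq S\times T$ that relates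 every $s\in S$ to at least one $t\in T$ and satisfies: $(s,t),(s',t')\in\tau$ implies $(ss',tt')\in\tau$. For classes $\mathbf{W},\mathbf{V}$ of finite semigroups, the Mal'cev product $\mathbf{W}\mathbin{\textcircled{m}}\mathbf{V}$ is the class of finite semigroups $S$ for which there are $T\in\mathbf{V}$ and a relational morphism $\tau$ from $S$ to $T$ such that, for every $e\in E(T)$, the subsemigroup $\{s\in S : (s,e)\in\tau\}$ of $S$ is empty or belongs to $\mathbf{W}$. Let $\mathbf{V}$ be an $\mathrm{FO}[\cdot]$-definable pseudovariety of finite semigroups. Then the Mal'cev products $\mathbf{K}\mathbin{\textcircled{m}}\mathbf{V}$, $\mathbf{D}\mathbin{\textcircled{m}}\mathbf{V}$, $\mathbf{N}\mathbin{\textcircled{m}}\mathbf{V}$, $\mathbb{L}\mathbf{I}\mathbin{\textcircled{m}}\mathbf{V}$ and $\mathbb{L}\mathbf{G}\mathbin{\textcircled{m}}\mathbf{V}$ are $\mathrm{FO}[\cdot]$-definable. -/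

import Mathlib

universe u

namespace FOMul

/-! ### Partial groupoids and first-order logic over the graph of multiplication -/

/-- A partial groupoid: a type with a partial binary operation
(`none` means that the product is undefined). -/
class PartialGroupoid (G : Type u) where
  /-- The partial multiplication. -/
  pmul : G → G → Option G

/-- The only relation symbol of the language: a ternary one, read as `x y = z`. -/
inductive MulRel : ℕ → Type
  | graph : MulRel 3

/-- The relational first-order language `FO[·]`: no function symbols, and one ternary relation
symbol for the graph of the multiplication. -/
def mulLang : FirstOrder.Language where
  Functions := fun _ => Empty
  Relations := MulRel

/-- A partial groupoid interprets the relation symbol by the graph of its multiplication. -/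
instance (G : Type u) [PartialGroupoid G] : mulLang.Structure G where
  funMap := fun f _ => Empty.elim f
  RelMap := fun r => match r with
    | MulRel.graph => fun v => PartialGroupoid.pmul (v 0) (v 1) = some (v 2)

/-- A class of finite non-empty partial groupoids is definable if some sentence holds in exactly
those finite non-empty partial groupoids that belong to the class. -/
def Definable (C : ∀ (G : Type u) [PartialGroupoid G], Prop) : Prop :=
  ∃ φ : mulLang.Sentence, ∀ (G : Type u) [PartialGroupoid G] [Finite G] [Nonempty G],
    C G ↔ FirstOrder.Language.Sentence.Realize G φ

/-! ### Classes of semigroups -/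

/-- A class of semigroups. The classes used below have only finite non-empty members. -/
abbrev SemigroupClass : Type (u + 1) :=
  ∀ (S : Type u) [Semigroup S], Prop

/-- A class of semigroups, seen as a class of partial groupoids: the multiplication is everywhere
defined, associative, and yields a semigroup in the class. -/
def SemigroupClass.toPartial (V : SemigroupClass.{u}) (G : Type u) [PartialGroupoid G] : Prop :=
  ∃ i : Semigroup G, (∀ x y : G, PartialGroupoid.pmul x y = some (x * y)) ∧ @V G i

/-- A class of finite semigroups is `FO[·]`-definable if it is so as a class of finite partial
groupoids. -/
def SemigroupClass.FODefinable (V : SemigroupClass.{u}) : Prop :=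
  Definable.{u} (fun G _ => V.toPartial G)

/-- Pseudovarieties of finite semigroups: non-empty classes of finite (non-empty) semigroups that
are closed under finite direct products, (non-empty) subsemigroups and quotients, i.e. images under
surjective morphisms. -/
structure IsPseudovariety (V : SemigroupClass.{u}) : Prop where
  finite : ∀ (S : Type u) [Semigroup S], V S → Finite S
  nonempty : ∀ (S : Type u) [Semigroup S], V S → Nonempty S
  exists_mem : ∃ (S : Type u) (i : Semigroup S), @V S i
  prod : ∀ (S T : Type u) [Semigroup S] [Semigroup T], V S → V T → V (S × T)
  subsemigroup : ∀ (S : Type u) [Semigroup S] (T : Subsemigroup S), V S → Nonempty T → V T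
  quotient : ∀ (S T : Type u) [Semigroup S] [Semigroup T] (f : S →ₙ* T),
    Function.Surjective f → V S → V T

/-- `K`: the finite semigroups with `x e = e` for every idempotent `e` and every `x`. -/
def classK : SemigroupClass.{u} := fun S _ =>
  Finite S ∧ Nonempty S ∧ ∀ e x : S, IsIdempotentElem e → x * e = e

/-- `D`: the finite semigroups with `e x = e` for every idempotent `e` and every `x`. -/
def classD : SemigroupClass.{u} := fun S _ =>
  Finite S ∧ Nonempty S ∧ ∀ e x : S, IsIdempotentElem e → e * x = e

/-- `N`: the finite nilpotent semigroups, i.e. those in which every idempotent is a zero. -/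
def classN : SemigroupClass.{u} := fun S _ =>
  Finite S ∧ Nonempty S ∧ ∀ e x : S, IsIdempotentElem e → e * x = e ∧ x * e = e

/-- `I`: the one-element semigroups. -/
def classI : SemigroupClass.{u} := fun S _ =>
  Nonempty S ∧ ∀ x y : S, x = y

/-- `G`: the finite groups, as semigroups. -/
def classG : SemigroupClass.{u} := fun S _ =>
  Finite S ∧ ∃ o : S, ∀ x : S, o * x = x ∧ x * o = x ∧ ∃ y : S, x * y = o ∧ y * x = o

/-- The subsemigroup `e S e` of `S`. -/
def corner {S : Type u} [Semigroup S] (e : S) : Subsemigroup S where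
  carrier := {x | ∃ s : S, x = e * s * e}
  mul_mem' := by
    rintro _ _ ⟨s, rfl⟩ ⟨t, rfl⟩
    exact ⟨s * e * e * t, by simp only [mul_assoc]⟩

/-- `L V`: the finite semigroups `S` such that `e S e` belongs to `V` for every idempotent `e`. -/
def localClass (V : SemigroupClass.{u}) : SemigroupClass.{u} := fun S _ =>
  Finite S ∧ Nonempty S ∧ ∀ e : S, IsIdempotentElem e → V (corner e)

/-! ### Mal'cev products -/

/-- A relational morphism from `S` to `T`: a relation that relates every element of `S` to some
element of `T` and is compatible with multiplication. -/
structure RelMorphism (S T : Type u) [Semigroup S] [Semigroup T] where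
  rel : S → T → Prop
  total : ∀ s : S, ∃ t : T, rel s t
  mul : ∀ {s s' : S} {t t' : T}, rel s t → rel s' t' → rel (s * s') (t * t')

/-- The inverse image of an idempotent under a relational morphism. -/
def RelMorphism.fiber {S T : Type u} [Semigroup S] [Semigroup T] (τ : RelMorphism S T)
    (e : T) (he : IsIdempotentElem e) : Subsemigroup S where
  carrier := {s | τ.rel s e}
  mul_mem' := fun {a b} ha hb => by
    have h : τ.rel (a * b) (e * e) := τ.mul ha hb
    rw [he.eq] at h
    exact h

/-- The Mal'cev product of `V` and `W`: the finite semigroups `S` that have a relational morphism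
to some `T` in `W` under which the inverse image of each idempotent of `T`, if it is non-empty,
belongs to `V`. -/
def malcev (V W : SemigroupClass.{u}) : SemigroupClass.{u} := fun S _ =>
  Finite S ∧ Nonempty S ∧ ∃ (T : Type u) (_ : Semigroup T) (τ : RelMorphism S T),
    W T ∧ ∀ (e : T) (he : IsIdempotentElem e), Nonempty (τ.fiber e he) → V (τ.fiber e he)

end FOMul

/-! For each of the five classes W there is a first-order definable congruence c such that a finite
S lies in the Mal'cev product of W with V exactly when S/c lies in V. Two properties of c suffice
(`malcev_iff_quotient`): a subsemigroup inside one c-class is in W, and a relational morphism with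
idempotent fibers in W relates only c-congruent elements to a common t. The first makes the
projection S → S/c a witness for the product; the second makes S/c a quotient of a subsemigroup of
T. Definability passes from V to the product by interpreting S/c in S (`DefRel.quotient`).

The congruences compare s and t only where they act reversibly. For K, s x = t x is required when
one of these is L-related to x; D is dual, and N is the meet. For LI, x s y = x t y is required when
one of these is R-related to x and L-related to y (`Links`); for LG, s and t need only satisfy
`Links` for the same pairs (x, y).

The harder property is the second. Reversibility gives a product p of s and some u that fixes a
suitable element. An idempotent power of p, taken simultaneously in S and T, contains s as a factor;
replacing that factor by s' stays in the same idempotent fiber, where the law of W applies. -/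

namespace FOMul

open FirstOrder FirstOrder.Language

/-! ### Definable relations on semigroups -/

/-- A relation symbol applied to three terms. -/
def graphFormula {α : Type} {n : ℕ} (s t r : mulLang.Term (α ⊕ Fin n)) :
    mulLang.BoundedFormula α n :=
  Relations.boundedFormula (L := mulLang) (n := 3) MulRel.graph ![s, t, r]

theorem realize_graphFormula {α : Type} {n : ℕ} (s t r : mulLang.Term (α ⊕ Fin n))
    {G : Type u} [PartialGroupoid G] (v : α → G) (xs : Fin n → G) :
    (graphFormula s t r).Realize v xs ↔
      PartialGroupoid.pmul (s.realize (Sum.elim v xs)) (t.realize (Sum.elim v xs)) =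
        some (r.realize (Sum.elim v xs)) := by
  rfl

/-- The multiplication of `G` as a partial groupoid is the one of `G` as a semigroup. -/
def Agrees (G : Type u) [PartialGroupoid G] [Semigroup G] : Prop :=
  ∀ x y : G, PartialGroupoid.pmul x y = some (x * y)

/-- A family of `n`-ary relations on semigroups is definable if it is uniformly given by a formula
in the language `FO[·]`. -/
def DefRel (n : ℕ) (P : ∀ (G : Type u) [Semigroup G], (Fin n → G) → Prop) : Prop :=
  ∃ φ : mulLang.Formula (Fin n), ∀ (G : Type u) [PartialGroupoid G] [Semigroup G],
    Agrees G → ∀ v : Fin n → G, P G v ↔ φ.Realize v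

/-- A family of `n`-ary operations on semigroups is definable if its graph is. -/
def DefFun (n : ℕ) (f : ∀ (G : Type u) [Semigroup G], (Fin n → G) → G) : Prop :=
  DefRel.{u} (n + 1) fun G _ v => f G (Fin.tail v) = v 0

namespace DefRel

variable {n : ℕ} {P Q : ∀ (G : Type u) [Semigroup G], (Fin n → G) → Prop}

theorem imp (hP : DefRel n P) (hQ : DefRel n Q) : DefRel n fun G _ v => P G v → Q G v := by
  obtain ⟨φ, hφ⟩ := hP
  obtain ⟨ψ, hψ⟩ := hQ
  exact ⟨φ.imp ψ, fun G _ _ h v => by simp only [hφ G h, hψ G h, Formula.realize_imp]⟩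

theorem and (hP : DefRel n P) (hQ : DefRel n Q) : DefRel n fun G _ v => P G v ∧ Q G v := by
  obtain ⟨φ, hφ⟩ := hP
  obtain ⟨ψ, hψ⟩ := hQ
  exact ⟨φ ⊓ ψ, fun G _ _ h v => by simp only [hφ G h, hψ G h, Formula.realize_inf]⟩

theorem or (hP : DefRel n P) (hQ : DefRel n Q) : DefRel n fun G _ v => P G v ∨ Q G v := by
  obtain ⟨φ, hφ⟩ := hP
  obtain ⟨ψ, hψ⟩ := hQ
  exact ⟨φ ⊔ ψ, fun G _ _ h v => by simp only [hφ G h, hψ G h, Formula.realize_sup]⟩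

theorem iff (hP : DefRel n P) (hQ : DefRel n Q) : DefRel n fun G _ v => (P G v ↔ Q G v) := by
  obtain ⟨φ, hφ⟩ := hP
  obtain ⟨ψ, hψ⟩ := hQ
  exact ⟨φ.iff ψ, fun G _ _ h v => by simp only [hφ G h, hψ G h, Formula.realize_iff]⟩

theorem sumElim_cons {G : Type u} (v : Fin n → G) (i : Unit → G) :
    (fun a => Sum.elim v i a) ∘ Fin.cons (Sum.inr ()) Sum.inl =
      (Fin.cons (i ()) v : Fin (n + 1) → G) := by
  funext a
  refine Fin.cases ?_ (fun a => ?_) a <;> simp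

theorem all {P : ∀ (G : Type u) [Semigroup G], (Fin (n + 1) → G) → Prop}
    (hP : DefRel (n + 1) P) : DefRel n fun G _ v => ∀ x : G, P G (Fin.cons x v) := by
  obtain ⟨φ, hφ⟩ := hP
  refine ⟨Formula.iAlls Unit (φ.relabel (Fin.cons (Sum.inr ()) Sum.inl)),
    fun G _ _ h v => ?_⟩
  simp only [Formula.realize_iAlls, Formula.realize_relabel, sumElim_cons, hφ G h]
  exact ⟨fun H i => H (i ()), fun H x => H fun _ => x⟩

theorem ex {P : ∀ (G : Type u) [Semigroup G], (Fin (n + 1) → G) → Prop}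
    (hP : DefRel (n + 1) P) : DefRel n fun G _ v => ∃ x : G, P G (Fin.cons x v) := by
  obtain ⟨φ, hφ⟩ := hP
  refine ⟨Formula.iExs Unit (φ.relabel (Fin.cons (Sum.inr ()) Sum.inl)),
    fun G _ _ h v => ?_⟩
  simp only [Formula.realize_iExs, Formula.realize_relabel, sumElim_cons, hφ G h]
  exact ⟨fun ⟨x, H⟩ => ⟨fun _ => x, H⟩, fun ⟨i, H⟩ => ⟨i (), H⟩⟩

theorem relabel {m : ℕ} (hP : DefRel n P) (g : Fin n → Fin m) :
    DefRel m fun G _ v => P G (v ∘ g) := by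
  obtain ⟨φ, hφ⟩ := hP
  exact ⟨φ.relabel g, fun G _ _ h v => by simp only [hφ G h, Formula.realize_relabel]⟩

theorem graph (i j k : Fin n) : DefRel.{u} n fun _ _ v => v i * v j = v k := by
  refine ⟨graphFormula (Term.var (Sum.inl i)) (Term.var (Sum.inl j)) (Term.var (Sum.inl k)),
    fun G _ _ h v => ?_⟩
  rw [Formula.Realize, realize_graphFormula]
  simp [h _ _]

theorem congr {P' : ∀ (G : Type u) [Semigroup G], (Fin n → G) → Prop} (hP : DefRel n P)
    (h : ∀ (G : Type u) [Semigroup G] (v : Fin n → G), P G v ↔ P' G v) : DefRel n P' := by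
  obtain ⟨φ, hφ⟩ := hP
  exact ⟨φ, fun G _ _ hG v => by rw [← h, hφ G hG]⟩

end DefRel

namespace DefFun

variable {n : ℕ} {f g : ∀ (G : Type u) [Semigroup G], (Fin n → G) → G}

theorem var (i : Fin n) : DefFun.{u} n fun _ _ v => v i :=
  ⟨Term.equal (Term.var i.succ) (Term.var 0), fun G _ _ _ v => by
    simp [Formula.realize_equal, Fin.tail]⟩

theorem mul (hf : DefFun n f) (hg : DefFun n g) : DefFun n fun G _ v => f G v * g G v := by
  -- Positions after the shift: 0 is the value of `g`, 1 the value of `f`, 2 the product, and the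
  -- arguments start at 3.
  have key := (((hf.relabel (m := n + 3)
    (Fin.cons 1 fun i => i.succ.succ.succ)).and
    (hg.relabel (m := n + 3) (Fin.cons 0 fun i => i.succ.succ.succ))).and
    (DefRel.graph 1 0 2)).ex.ex
  refine key.congr fun G _ v => ?_
  constructor
  · rintro ⟨p, q, ⟨hp, hq⟩, h⟩
    change f G (Fin.tail v) = p at hp
    change g G (Fin.tail v) = q at hq
    change p * q = v 0 at h
    change f G (Fin.tail v) * g G (Fin.tail v) = v 0
    rw [hp, hq, h]
  · intro h
    exact ⟨f G (Fin.tail v), g G (Fin.tail v), ⟨rfl, rfl⟩, h⟩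

theorem eq (hf : DefFun n f) (hg : DefFun n g) : DefRel n fun G _ v => f G v = g G v := by
  refine (hf.and hg).ex.congr fun G _ v => ?_
  constructor
  · rintro ⟨p, hp, hq⟩
    exact hp.trans hq.symm
  · intro h
    exact ⟨g G v, h, rfl⟩

end DefFun

/-! ### Definability in quotients -/

/-- Every semigroup is a partial groupoid. -/
abbrev groupoidOf (G : Type u) [Semigroup G] : PartialGroupoid G := ⟨fun x y => some (x * y)⟩

theorem surjective_coe_quotient {S : Type u} [Mul S] (c : Con S) :
    Function.Surjective ((↑) : S → c.Quotient) :=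
  fun q => Con.induction_on q fun x => ⟨x, rfl⟩

theorem exists_eq_var {n : ℕ} (t : mulLang.Term (Empty ⊕ Fin n)) :
    ∃ i : Fin n, t = Term.var (Sum.inr i) := by
  cases t with
  | var a =>
    rcases a with a | i
    · exact a.elim
    · exact ⟨i, rfl⟩
  | func f ts => exact Empty.elim f

/-- The quotient is interpreted in `S` by representatives: equality becomes `c`, the graph of
multiplication becomes multiplication up to `c`, and quantifiers carry over because the projection
is surjective. -/
theorem DefRel.quotient (c : ∀ (S : Type u) [Semigroup S], Con S)
    (hc : DefRel.{u} 2 fun S _ v => c S (v 0) (v 1)) {n : ℕ}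
    (φ : mulLang.BoundedFormula Empty n) :
    DefRel.{u} n fun S _ v =>
      letI := groupoidOf (c S).Quotient
      φ.Realize Empty.elim fun i => (v i : (c S).Quotient) := by
  induction φ with
  | falsum =>
    exact ⟨⊥, fun G _ _ _ v => by simp [Formula.Realize, BoundedFormula.Realize]⟩
  | equal s t =>
    obtain ⟨i, rfl⟩ := exists_eq_var s
    obtain ⟨j, rfl⟩ := exists_eq_var t
    refine (hc.relabel ![i, j]).congr fun S _ v => ?_
    simp [BoundedFormula.Realize, Con.eq]
  | rel R ts =>
    cases R
    obtain ⟨i, hi⟩ := exists_eq_var (ts 0)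
    obtain ⟨j, hj⟩ := exists_eq_var (ts 1)
    obtain ⟨k, hk⟩ := exists_eq_var (ts 2)
    refine ((DefFun.mul (.var (Fin.succ i)) (.var (Fin.succ j))).eq (.var 0) |>.and
      (hc.relabel ![0, Fin.succ k])).ex.congr fun S _ v => ?_
    let _ := groupoidOf (c S).Quotient
    change _ ↔ PartialGroupoid.pmul ((ts 0).realize _) ((ts 1).realize _) =
      some ((ts 2).realize _)
    simp [hi, hj, hk, PartialGroupoid.pmul, ← Con.coe_mul, Con.eq]
  | imp φ ψ hφ hψ => exact hφ.imp hψ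
  | all φ hφ =>
    -- A bounded formula binds its last variable, whereas `DefRel.all` binds position 0.
    refine (hφ.relabel (Fin.snoc Fin.succ 0)).all.congr fun S _ v => ?_
    let _ := groupoidOf (c S).Quotient
    rw [BoundedFormula.realize_all, (surjective_coe_quotient (c S)).forall]
    refine forall_congr' fun x => ?_
    refine iff_of_eq (congrArg _ (funext fun i => ?_))
    refine Fin.lastCases ?_ (fun i => ?_) i <;> simp

/-- The sentence that the multiplication is everywhere defined. -/
def totalSentence : mulLang.Sentence :=
  (graphFormula (n := 3) (Term.var (Sum.inr 0)) (Term.var (Sum.inr 1))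
    (Term.var (Sum.inr 2))).ex.all.all

/-- The sentence that the multiplication is associative, for everywhere defined ones. -/
def assocSentence : mulLang.Sentence :=
  ((graphFormula (n := 6) (Term.var (Sum.inr 0)) (Term.var (Sum.inr 1))
    (Term.var (Sum.inr 3))).imp
  ((graphFormula (n := 6) (Term.var (Sum.inr 3)) (Term.var (Sum.inr 2))
    (Term.var (Sum.inr 4))).imp
  ((graphFormula (n := 6) (Term.var (Sum.inr 1)) (Term.var (Sum.inr 2))
    (Term.var (Sum.inr 5))).imp
  (graphFormula (n := 6) (Term.var (Sum.inr 0)) (Term.var (Sum.inr 5))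
    (Term.var (Sum.inr 4)))))).all.all.all.all.all.all

theorem realize_totalSentence (G : Type u) [PartialGroupoid G] :
    Sentence.Realize G totalSentence ↔ ∀ x y : G, ∃ z, PartialGroupoid.pmul x y = some z := by
  simp only [Sentence.Realize, Formula.Realize, totalSentence, BoundedFormula.realize_all,
    BoundedFormula.realize_ex, realize_graphFormula]
  exact Iff.rfl

theorem realize_assocSentence (G : Type u) [PartialGroupoid G] :
    Sentence.Realize G assocSentence ↔ ∀ x y z p q r : G, PartialGroupoid.pmul x y = some p →
      PartialGroupoid.pmul p z = some q → PartialGroupoid.pmul y z = some r →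
      PartialGroupoid.pmul x r = some q := by
  simp only [Sentence.Realize, Formula.Realize, assocSentence, BoundedFormula.realize_all,
    BoundedFormula.realize_imp, realize_graphFormula]
  exact Iff.rfl

theorem realize_semigroup_iff (G : Type u) [PartialGroupoid G] :
    Sentence.Realize G (totalSentence ⊓ assocSentence) ↔ ∃ _ : Semigroup G, Agrees G := by
  rw [Sentence.realize_inf, realize_totalSentence, realize_assocSentence]
  constructor
  · rintro ⟨h, ha⟩
    choose m hm using h
    exact ⟨{ mul := m, mul_assoc := fun x y z => (Option.some_injective _
      ((hm _ _).symm.trans (ha _ _ _ _ _ _ (hm x y) (hm _ z) (hm y z)))).symm }, hm⟩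
  · rintro ⟨_, h⟩
    refine ⟨fun x y => ⟨_, h x y⟩, fun x y z p q r => ?_⟩
    simp only [h _ _, Option.some.injEq]
    rintro rfl rfl rfl
    rw [mul_assoc]

/-- This makes the semigroup quantified in `toPartial` irrelevant: the graph determines it. -/
theorem Agrees.unique {G : Type u} [PartialGroupoid G] {i j : Semigroup G} (hi : @Agrees G _ i)
    (hj : @Agrees G _ j) : i = j :=
  Semigroup.ext (funext fun x => funext fun y =>
    Option.some_injective _ ((hi x y).symm.trans (hj x y)))

theorem SemigroupClass.toPartial_iff (V : SemigroupClass.{u}) {G : Type u} [PartialGroupoid G]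
    [i : Semigroup G] (h : Agrees G) : V.toPartial G ↔ V G := by
  constructor
  · rintro ⟨j, hj, hV⟩
    obtain rfl : i = j := Agrees.unique h hj
    exact hV
  · exact fun hV => ⟨i, h, hV⟩

/-- If `V` is definable and `c` is a definable congruence, then the class of the semigroups whose
quotient by `c` belongs to `V` is definable. -/
theorem SemigroupClass.FODefinable.of_quotient {V W : SemigroupClass.{u}} (hV : V.FODefinable)
    (c : ∀ (S : Type u) [Semigroup S], Con S)
    (hc : DefRel.{u} 2 fun S _ v => c S (v 0) (v 1))
    (h : ∀ (S : Type u) [Semigroup S] [Finite S] [Nonempty S], W S ↔ V (c S).Quotient) :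
    W.FODefinable := by
  obtain ⟨φ, hφ⟩ := hV
  obtain ⟨ψ, hψ⟩ := DefRel.quotient c hc φ
  refine ⟨(totalSentence ⊓ assocSentence) ⊓ ψ.relabel Fin.elim0, fun G _ _ _ => ?_⟩
  have key : ∀ [Semigroup G], Agrees G →
      (W.toPartial G ↔ Sentence.Realize G (ψ.relabel Fin.elim0)) := by
    intro _ hG
    let _ := groupoidOf (c G).Quotient
    rw [W.toPartial_iff hG, h G, ← V.toPartial_iff (G := (c G).Quotient) (fun _ _ => rfl),
      Sentence.Realize, Formula.realize_relabel, ← hψ G hG]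
    have : Finite (c G).Quotient := Finite.of_surjective _ (surjective_coe_quotient (c G))
    have : Nonempty (c G).Quotient := ⟨((Classical.arbitrary G : G) : (c G).Quotient)⟩
    refine (hφ _).trans (iff_of_eq ?_)
    rw [Sentence.Realize, Formula.Realize]
    -- Only the valuations of an empty set of variables differ.
    congr 1
    · exact Subsingleton.elim _ _
    · exact Subsingleton.elim _ _
  rw [Sentence.realize_inf, realize_semigroup_iff]
  constructor
  · intro hW
    obtain ⟨i, hi, hS⟩ := id hW
    exact ⟨⟨i, hi⟩, (key hi).1 hW⟩
  · rintro ⟨⟨i, hi⟩, hS⟩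
    exact (key hi).2 hS

/-! ### Mal'cev products through quotients -/

/-- A semigroup has a relational morphism to a member of `V` with fibers in `W` if and only if its
quotient by `c` belongs to `V`, when `c` has the properties of a largest congruence all of whose
idempotent classes belong to `W`. -/
theorem malcev_iff_quotient {V W : SemigroupClass.{u}} (hV : IsPseudovariety V)
    (c : ∀ (S : Type u) [Semigroup S], Con S)
    (hfib : ∀ (S : Type u) [Semigroup S] [Finite S] (F : Subsemigroup S), Nonempty F →
      (∀ x ∈ F, ∀ y ∈ F, c S x y) → W F)
    (hrel : ∀ (S T : Type u) [Semigroup S] [Semigroup T] [Finite S] [Finite T]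
      (τ : RelMorphism S T),
      (∀ (e : T) (he : IsIdempotentElem e), Nonempty (τ.fiber e he) → W (τ.fiber e he)) →
      ∀ s s' t, τ.rel s t → τ.rel s' t → c S s s')
    (S : Type u) [Semigroup S] [Finite S] [Nonempty S] :
    malcev W V S ↔ V (c S).Quotient := by
  constructor
  · rintro ⟨-, -, T, _, τ, hT, hW⟩
    have := hV.finite T hT
    let T' : Subsemigroup T :=
      { carrier := {t | ∃ s, τ.rel s t}
        mul_mem' := fun ⟨s, hs⟩ ⟨s', hs'⟩ => ⟨s * s', τ.mul hs hs'⟩ }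
    have hT' : V T' := hV.subsemigroup T T' hT (by
      obtain ⟨t, ht⟩ := τ.total (Classical.arbitrary S)
      exact ⟨⟨t, _, ht⟩⟩)
    choose r hr using fun t : T' => t.2
    -- By `hrel` the class of `r t` does not depend on the choice of `r`, so `t ↦ [r t]` is a
    -- surjective morphism.
    have heq : ∀ (s : S) (t : T'), τ.rel s t → ((r t : S) : (c S).Quotient) = s :=
      fun s t h => (Con.eq _).2 (hrel S T τ hW _ _ _ (hr t) h)
    refine hV.quotient T' _ ⟨fun t => ((r t : S) : (c S).Quotient), fun t t' => ?_⟩ ?_ hT'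
    · rw [← Con.coe_mul]
      exact heq _ _ (τ.mul (hr t) (hr t'))
    · intro q
      obtain ⟨s, rfl⟩ := surjective_coe_quotient _ q
      obtain ⟨t, ht⟩ := τ.total s
      exact ⟨⟨t, s, ht⟩, heq _ _ ht⟩
  · intro h
    refine ⟨inferInstance, inferInstance, (c S).Quotient, inferInstance,
      ⟨fun s q => (s : (c S).Quotient) = q, fun s => ⟨_, rfl⟩, ?_⟩, h, fun e he hne => ?_⟩
    · rintro s s' _ _ rfl rfl
      exact Con.coe_mul s s'
    · exact hfib S _ hne fun x hx y hy => (Con.eq _).1 (Eq.trans hx (Eq.symm hy))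

/-! ### Idempotent powers -/

/-- The idempotent power is displayed as `p * k` so that one factor `p` can later be altered. Its
existence is the compact semigroup theorem for the discrete topology. -/
theorem exists_mem_closure_isIdempotentElem_mul {M : Type*} [Semigroup M] [Finite M] (p : M) :
    ∃ k ∈ Subsemigroup.closure {p}, p * k = k * p ∧ IsIdempotentElem (p * k) := by
  have hp : p ∈ Subsemigroup.closure {p} := Subsemigroup.subset_closure rfl
  have hcomm : ∀ k ∈ Subsemigroup.closure {p}, p * k = k * p := by
    intro k hk
    induction hk using Subsemigroup.closure_induction with
    | mem x hx => rw [Set.mem_singleton_iff.1 hx]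
    | mul x y _ _ hx hy => rw [← mul_assoc, hx, mul_assoc, hy, mul_assoc]
  have hdiv : ∀ e ∈ Subsemigroup.closure {p}, e = p ∨ ∃ k ∈ Subsemigroup.closure {p},
      e = p * k := by
    intro e he
    induction he using Subsemigroup.closure_induction with
    | mem x hx => exact Or.inl hx
    | mul x y _ hy hx _ =>
      right
      rcases hx with rfl | ⟨k, hk, rfl⟩
      · exact ⟨y, hy, rfl⟩
      · exact ⟨k * y, mul_mem hk hy, mul_assoc _ _ _⟩
  let _ : TopologicalSpace (Subsemigroup.closure {p}) := ⊥
  have : DiscreteTopology (Subsemigroup.closure {p}) := ⟨rfl⟩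
  have : Nonempty (Subsemigroup.closure {p}) := ⟨⟨p, hp⟩⟩
  obtain ⟨⟨e, he⟩, hee⟩ := exists_idempotent_of_compact_t2_of_continuous_mul_left
    (M := Subsemigroup.closure {p}) fun _ => continuous_of_discreteTopology
  replace hee : e * e = e := congrArg Subtype.val hee
  rcases hdiv e he with rfl | ⟨k, hk, rfl⟩
  -- Without an identity, an idempotent `p` itself must serve as `k`.
  · exact ⟨e, hp, rfl, by rw [hee]; exact hee⟩
  · exact ⟨k, hk, hcomm k hk, hee⟩

/-- For related elements `s` and `t`, a relational morphism relates suitable simultaneous powers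
`k` and `l`. -/
theorem RelMorphism.exists_isIdempotentElem {S T : Type u} [Semigroup S] [Semigroup T] [Finite S]
    [Finite T] (τ : RelMorphism S T) {s : S} {t : T} (h : τ.rel s t) :
    ∃ k l, τ.rel k l ∧ s * k = k * s ∧ t * l = l * t ∧ IsIdempotentElem (s * k) ∧
      IsIdempotentElem (t * l) ∧ (∀ y, s * y = y → k * y = y) ∧ (∀ x, x * s = x → x * k = x) := by
  obtain ⟨⟨k, l⟩, hk, hcomm, hidem⟩ := exists_mem_closure_isIdempotentElem_mul (s, t)
  -- Working in `S × T` makes the powers simultaneous; the graph of `τ` and the stabilizers of `y`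
  -- and `x` are subsemigroups, hence inherited by `(k, l)`.
  have hC : ∀ C : Subsemigroup (S × T), (s, t) ∈ C → (k, l) ∈ C := fun C hC =>
    Subsemigroup.closure_le.2 (Set.singleton_subset_iff.2 hC) hk
  refine ⟨k, l, ?_, congrArg Prod.fst hcomm, congrArg Prod.snd hcomm, congrArg Prod.fst hidem,
    congrArg Prod.snd hidem, fun y hy => ?_, fun x hx => ?_⟩
  · exact hC { carrier := {p | τ.rel p.1 p.2}, mul_mem' := fun ha hb => τ.mul ha hb } h
  · refine hC { carrier := {p | p.1 * y = y}, mul_mem' := fun {a b} ha hb => ?_ } hy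
    change a.1 * b.1 * y = y
    rw [mul_assoc, show b.1 * y = y from hb, show a.1 * y = y from ha]
  · refine hC { carrier := {p | x * p.1 = x}, mul_mem' := fun {a b} ha hb => ?_ } hx
    change x * (a.1 * b.1) = x
    rw [← mul_assoc, show x * a.1 = x from ha, show x * b.1 = x from hb]

/-! ### The congruences -/

/-- The equivalence relation under which `s` and `t` have the same image under `f i` whenever one
of them satisfies `D i`. -/
def agreeSetoid {ι S β : Type*} (D : ι → S → Prop) (f : ι → S → β)
    (h : ∀ i s t, D i s → f i s = f i t → D i t) : Setoid S where
  r s t := ∀ i, D i s ∨ D i t → f i s = f i t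
  iseqv :=
    { refl := fun _ _ _ => rfl
      symm := fun hst i hi => (hst i hi.symm).symm
      -- Agreement at `i` carries `D i` to the middle element, which then activates the other
      -- hypothesis.
      trans := fun {s t r} hst htr i hi => by
        rcases hi with hi | hi
        · have h1 := hst i (Or.inl hi)
          exact h1.trans (htr i (Or.inl (h i s t hi h1)))
        · have h1 := htr i (Or.inr hi)
          exact (hst i (Or.inr (h i r t hi h1.symm))).trans h1 }

/-- An equivalence relation that is compatible with translations is a congruence. -/
def conOfTranslations {S : Type*} [Semigroup S] (r : Setoid S)
    (hl : ∀ a s t : S, r s t → r (a * s) (a * t)) (hr : ∀ a s t : S, r s t → r (s * a) (t * a)) :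
    Con S :=
  { r with mul' := fun {s t s' t'} h h' => r.trans (hr s' s t h) (hl t s' t' h') }

section Congruences

variable (S : Type u) [Semigroup S]

/-- The largest congruence of a finite semigroup with idempotent classes in `K`. -/
def conK : Con S :=
  conOfTranslations
    (agreeSetoid (fun (x : S) s => ∃ u, u * (s * x) = x) (fun x s => s * x)
      (fun x s t hs h => by rwa [← h]))
    (fun a s t h x hx => by
      have := h x (hx.imp (fun ⟨u, hu⟩ => ⟨u * a, by simpa only [mul_assoc] using hu⟩)
        fun ⟨u, hu⟩ => ⟨u * a, by simpa only [mul_assoc] using hu⟩)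
      simp only [mul_assoc, this])
    (fun a s t h x hx => by
      have := h (a * x) (hx.imp
        (fun ⟨u, hu⟩ => ⟨a * u, by simpa only [mul_assoc] using congrArg (a * ·) hu⟩)
        fun ⟨u, hu⟩ => ⟨a * u, by simpa only [mul_assoc] using congrArg (a * ·) hu⟩)
      simpa only [mul_assoc] using this)

/-- The largest congruence of a finite semigroup with idempotent classes in `D`. -/
def conD : Con S :=
  conOfTranslations
    (agreeSetoid (fun (x : S) s => ∃ u, x * s * u = x) (fun x s => x * s)
      (fun x s t hs h => by rwa [← h]))
    (fun a s t h x hx => by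
      have := h (x * a) (hx.imp
        (fun ⟨u, hu⟩ => ⟨u * a, by simpa only [mul_assoc] using congrArg (· * a) hu⟩)
        fun ⟨u, hu⟩ => ⟨u * a, by simpa only [mul_assoc] using congrArg (· * a) hu⟩)
      simpa only [mul_assoc] using this)
    (fun a s t h x hx => by
      have := h x (hx.imp (fun ⟨u, hu⟩ => ⟨a * u, by simpa only [mul_assoc] using hu⟩)
        fun ⟨u, hu⟩ => ⟨a * u, by simpa only [mul_assoc] using hu⟩)
      simp only [← mul_assoc, this])

/-- The largest congruence of a finite semigroup with idempotent classes in `N`. -/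
def conN : Con S := conK S ⊓ conD S

variable {S}

/-- The product `x * s * y` is `R`-related to `x` and `L`-related to `y`. -/
def Links (x y s : S) : Prop :=
  (∃ a, x * s * y * a = x) ∧ ∃ b, b * (x * s * y) = y

theorem Links.move_right {x y a s : S} (h : Links x y (s * a)) : Links x (a * y) s := by
  obtain ⟨⟨c, hc⟩, d, hd⟩ := h
  exact ⟨⟨c, by simpa only [mul_assoc] using hc⟩,
    ⟨a * d, by simpa only [mul_assoc] using congrArg (a * ·) hd⟩⟩

theorem Links.move_left {x y a s : S} (h : Links x y (a * s)) : Links (x * a) y s := by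
  obtain ⟨⟨c, hc⟩, d, hd⟩ := h
  exact ⟨⟨c * a, by simpa only [mul_assoc] using congrArg (· * a) hc⟩,
    ⟨d, by simpa only [mul_assoc] using hd⟩⟩

/-- Undoing `move_right` requires a way back from `a * y` to `y`; the multiplier `d * x * s`
supplied by `h` provides it. -/
theorem Links.of_move_right {x y a s t : S} (h : Links x y (s * a)) (h' : Links x (a * y) t) :
    Links x y (t * a) := by
  obtain ⟨-, d, hd⟩ := h
  obtain ⟨⟨c, hc⟩, d', hd'⟩ := h'
  refine ⟨⟨c, by simpa only [mul_assoc] using hc⟩, ⟨d * x * s * d', ?_⟩⟩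
  calc d * x * s * d' * (x * (t * a) * y) = d * x * s * (d' * (x * t * (a * y))) := by
        simp only [mul_assoc]
    _ = y := by rw [hd']; simpa only [mul_assoc] using hd

theorem Links.of_move_left {x y a s t : S} (h : Links x y (a * s)) (h' : Links (x * a) y t) :
    Links x y (a * t) := by
  obtain ⟨⟨c, hc⟩, -⟩ := h
  obtain ⟨⟨c', hc'⟩, d', hd'⟩ := h'
  refine ⟨⟨c' * s * y * c, ?_⟩, ⟨d', by simpa only [mul_assoc] using hd'⟩⟩
  calc x * (a * t) * y * (c' * s * y * c) = (x * a * t * y * c') * s * y * c := by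
        simp only [mul_assoc]
    _ = x := by rw [hc']; simpa only [mul_assoc] using hc

variable (S)

/-- The largest congruence of a finite semigroup with idempotent classes in `L I`. -/
def conLI : Con S :=
  conOfTranslations
    (agreeSetoid (fun (p : S × S) s => Links p.1 p.2 s) (fun p s => p.1 * s * p.2)
      (fun p s t hs h => by rwa [Links, ← h]))
    (fun a s t h p hp => by
      have := h (p.1 * a, p.2) (hp.imp Links.move_left Links.move_left)
      simpa only [mul_assoc] using this)
    (fun a s t h p hp => by
      have := h (p.1, a * p.2) (hp.imp Links.move_right Links.move_right)
      simpa only [mul_assoc] using this)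

/-- The largest congruence of a finite semigroup with idempotent classes in `L G`. -/
def conLG : Con S :=
  conOfTranslations
    { r := fun s t => ∀ x y, Links x y s ↔ Links x y t
      iseqv := ⟨fun _ _ _ => Iff.rfl, fun h x y => (h x y).symm,
        fun h h' x y => (h x y).trans (h' x y)⟩ }
    (fun _ _ _ h _ _ => ⟨fun H => H.of_move_left ((h _ _).1 H.move_left),
      fun H => H.of_move_left ((h _ _).2 H.move_left)⟩)
    (fun _ _ _ h _ _ => ⟨fun H => H.of_move_right ((h _ _).1 H.move_right),
      fun H => H.of_move_right ((h _ _).2 H.move_right)⟩)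

end Congruences

theorem conK_iff {S : Type u} [Semigroup S] {s t : S} : conK S s t ↔
    ∀ x : S, (∃ u, u * (s * x) = x) ∨ (∃ u, u * (t * x) = x) → s * x = t * x :=
  Iff.rfl

theorem conD_iff {S : Type u} [Semigroup S] {s t : S} : conD S s t ↔
    ∀ x : S, (∃ u, x * s * u = x) ∨ (∃ u, x * t * u = x) → x * s = x * t :=
  Iff.rfl

theorem conN_iff {S : Type u} [Semigroup S] {s t : S} :
    conN S s t ↔ conK S s t ∧ conD S s t :=
  Iff.rfl

theorem conLI_iff {S : Type u} [Semigroup S] {s t : S} : conLI S s t ↔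
    ∀ x y : S, Links x y s ∨ Links x y t → x * s * y = x * t * y :=
  ⟨fun h x y => h (x, y), fun h p => h p.1 p.2⟩

theorem conLG_iff {S : Type u} [Semigroup S] {s t : S} : conLG S s t ↔
    ∀ x y : S, Links x y s ↔ Links x y t :=
  Iff.rfl

/-! ### Definability of the congruences -/

theorem defRel_conK : DefRel.{u} 2 fun S _ v => conK S (v 0) (v 1) :=
  ((DefRel.or
    ((DefFun.var 0).mul ((DefFun.var 2).mul (.var 1)) |>.eq (.var 1)).ex
    ((DefFun.var 0).mul ((DefFun.var 3).mul (.var 1)) |>.eq (.var 1)).ex).imp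
    (((DefFun.var 1).mul (.var 0)).eq ((DefFun.var 2).mul (.var 0)))).all

theorem defRel_conD : DefRel.{u} 2 fun S _ v => conD S (v 0) (v 1) :=
  ((DefRel.or
    (((DefFun.var 1).mul (.var 2)).mul (.var 0) |>.eq (.var 1)).ex
    (((DefFun.var 1).mul (.var 3)).mul (.var 0) |>.eq (.var 1)).ex).imp
    (((DefFun.var 0).mul (.var 1)).eq ((DefFun.var 0).mul (.var 2)))).all

theorem defRel_conN : DefRel.{u} 2 fun S _ v => conN S (v 0) (v 1) :=
  defRel_conK.and defRel_conD

theorem defRel_links : DefRel.{u} 3 fun _ _ v => Links (v 0) (v 1) (v 2) :=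
  DefRel.and
    ((((DefFun.var 1).mul (.var 3)).mul (.var 2)).mul (.var 0) |>.eq (.var 1)).ex
    ((DefFun.var 0).mul (((DefFun.var 1).mul (.var 3)).mul (.var 2)) |>.eq (.var 2)).ex

theorem defRel_conLI : DefRel.{u} 2 fun S _ v => conLI S (v 0) (v 1) :=
  (((defRel_links.relabel ![1, 0, 2]).or (defRel_links.relabel ![1, 0, 3])).imp
    ((((DefFun.var 1).mul (.var 2)).mul (.var 0)).eq
      (((DefFun.var 1).mul (.var 3)).mul (.var 0)))).all.all.congr fun _ _ _ => conLI_iff.symm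

theorem defRel_conLG : DefRel.{u} 2 fun S _ v => conLG S (v 0) (v 1) :=
  ((defRel_links.relabel ![1, 0, 2]).iff (defRel_links.relabel ![1, 0, 3])).all.all

/-! ### Classes of the congruences -/

section Fibers

variable {S : Type u} [Semigroup S] [Finite S] (F : Subsemigroup S)

theorem classK_of_conK (hF : Nonempty F) (h : ∀ x ∈ F, ∀ y ∈ F, conK S x y) : classK F := by
  refine ⟨inferInstance, hF, fun e x he => Subtype.ext ?_⟩
  have he' : (e : S) * e = e := congrArg Subtype.val he
  -- Tested at `e` itself, where `e` acts reversibly, congruence gives `x * e = e * e`.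
  have := conK_iff.1 (h x x.2 e e.2) e (Or.inr ⟨e, by rw [he', he']⟩)
  rwa [he'] at this

theorem classD_of_conD (hF : Nonempty F) (h : ∀ x ∈ F, ∀ y ∈ F, conD S x y) : classD F := by
  refine ⟨inferInstance, hF, fun e x he => Subtype.ext ?_⟩
  have he' : (e : S) * e = e := congrArg Subtype.val he
  have := conD_iff.1 (h x x.2 e e.2) e (Or.inr ⟨e, by rw [he', he']⟩)
  rwa [he'] at this

theorem classN_iff {S : Type u} [Semigroup S] : classN S ↔ classD S ∧ classK S :=
  ⟨fun ⟨h, h', H⟩ => ⟨⟨h, h', fun e x he => (H e x he).1⟩, h, h', fun e x he => (H e x he).2⟩,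
    fun ⟨⟨h, h', H⟩, _, _, H'⟩ => ⟨h, h', fun e x he => ⟨H e x he, H' e x he⟩⟩⟩

theorem classN_of_conN (hF : Nonempty F) (h : ∀ x ∈ F, ∀ y ∈ F, conN S x y) : classN F :=
  classN_iff.2 ⟨classD_of_conD F hF fun x hx y hy => (conN_iff.1 (h x hx y hy)).2,
    classK_of_conK F hF fun x hx y hy => (conN_iff.1 (h x hx y hy)).1⟩

omit [Finite S] in
theorem links_of_isIdempotentElem {e : S} (he : IsIdempotentElem e) : Links e e e :=
  ⟨⟨e, by rw [he.eq, he.eq, he.eq]⟩, e, by rw [he.eq, he.eq, he.eq]⟩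

omit [Finite S] in
theorem mem_corner_iff {e x : S} (he : IsIdempotentElem e) :
    x ∈ corner e ↔ e * x = x ∧ x * e = x := by
  constructor
  · rintro ⟨s, rfl⟩
    exact ⟨by rw [← mul_assoc, ← mul_assoc, he.eq], by rw [mul_assoc, he.eq]⟩
  · rintro ⟨h, h'⟩
    exact ⟨x, by rw [h, h']⟩

theorem localClassI_of_conLI (hF : Nonempty F) (h : ∀ x ∈ F, ∀ y ∈ F, conLI S x y) :
    localClass classI F := by
  refine ⟨inferInstance, hF, fun e he => ⟨⟨⟨e * e * e, e, rfl⟩⟩, ?_⟩⟩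
  have he' : IsIdempotentElem (e : S) := congrArg Subtype.val he
  have key : ∀ s : F, e * s * e = e := fun s => Subtype.ext <| by
    have := conLI_iff.1 (h s s.2 e e.2) e e (Or.inr (links_of_isIdempotentElem he'))
    rwa [he'.eq, he'.eq] at this
  rintro ⟨_, s, rfl⟩ ⟨_, t, rfl⟩
  exact Subtype.ext ((key s).trans (key t).symm)

/-- A finite monoid in which every element is left invertible is a group. -/
theorem classG_of_left_inverse {M : Type u} [Semigroup M] [Finite M] (o : M)
    (ho : ∀ x : M, o * x = x ∧ x * o = x) (h : ∀ x : M, Function.Injective (x * ·)) :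
    classG M := by
  refine ⟨inferInstance, o, fun x => ⟨(ho x).1, (ho x).2, ?_⟩⟩
  obtain ⟨k, -, hk, hi⟩ := exists_mem_closure_isIdempotentElem_mul x
  -- Left cancellation leaves `o` as the only idempotent.
  have hxk : x * k = o := h (x * k) (hi.eq.trans (ho _).2.symm)
  exact ⟨k, hxk, hk ▸ hxk⟩

theorem localClassG_of_conLG (hF : Nonempty F) (h : ∀ x ∈ F, ∀ y ∈ F, conLG S x y) :
    localClass classG F := by
  refine ⟨inferInstance, hF, fun e he => ?_⟩
  have he' : IsIdempotentElem (e : S) := congrArg Subtype.val he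
  have hc := fun x : corner e => (mem_corner_iff he).1 x.2
  refine classG_of_left_inverse ⟨e, e, by rw [he.eq, he.eq]⟩
    (fun x => ⟨Subtype.ext (hc x).1, Subtype.ext (hc x).2⟩) fun x y z hyz => ?_
  -- The left inverse `b` of `x` need not lie in `F`, but it suffices for left cancellation in the
  -- corner.
  obtain ⟨-, b, hb⟩ := (conLG_iff.1 (h e e.2 x.1 x.1.2) e e).1 (links_of_isIdempotentElem he')
  have hx : (e : S) * x.1 * e = x.1 := by
    have := hc x
    exact congrArg Subtype.val (show e * x.1 * e = x.1 by rw [this.1, this.2])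
  rw [hx] at hb
  have hy : (e : S) * y.1 = y.1 := congrArg Subtype.val (hc y).1
  have hz : (e : S) * z.1 = z.1 := congrArg Subtype.val (hc z).1
  have hyz' : (x.1 : S) * y.1 = x.1 * z.1 := congrArg (fun q : corner e => (q.1 : S)) hyz
  refine Subtype.ext (Subtype.ext ?_)
  rw [← hy, ← hz, ← hb, mul_assoc, hyz', ← mul_assoc]

end Fibers

/-! ### Relational morphisms refine the congruences -/

section Relations

variable {S T : Type u} [Semigroup S] [Semigroup T] [Finite S] [Finite T] (τ : RelMorphism S T)

theorem conK_of_rel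
    (hτ : ∀ (e : T) (he : IsIdempotentElem e), Nonempty (τ.fiber e he) → classK (τ.fiber e he))
    (s s' : S) (t : T) (hs : τ.rel s t) (hs' : τ.rel s' t) : conK S s s' := by
  have key : ∀ s s' : S, τ.rel s t → τ.rel s' t → ∀ x, (∃ u, u * (s * x) = x) →
      s * x = s' * x := by
    rintro s s' hs hs' x ⟨u, hu⟩
    obtain ⟨v, hv⟩ := τ.total u
    obtain ⟨k, l, hkl, hk, hl, hi, hj, hy, -⟩ := τ.exists_isIdempotentElem (τ.mul hs hv)
    have hf : τ.rel (s * u * k) (t * v * l) := τ.mul (τ.mul hs hv) hkl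
    have hw : τ.rel (s' * u * k) (t * v * l) := τ.mul (τ.mul hs' hv) hkl
    -- The idempotent power of `s * u` and its variant with leading factor `s'` share a fiber, so
    -- the law of K applies; both sides then act on `s * x`, which `s * u` fixes.
    have hK := (hτ _ hj ⟨⟨_, hf⟩⟩).2.2 ⟨_, hf⟩ ⟨_, hw⟩ (Subtype.ext hi.eq)
    replace hK : s' * u * k * (s * u * k) = s * u * k := congrArg Subtype.val hK
    have h1 : s * u * (s * x) = s * x := by rw [mul_assoc, hu]
    have h2 : k * (s * x) = s * x := hy _ h1
    have h3 : s * u * k * (s * x) = s * x := by rw [mul_assoc, h2, h1]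
    calc s * x = s' * u * k * (s * u * k) * (s * x) := by rw [hK, h3]
      _ = s' * (u * (s * x)) := by
        rw [mul_assoc, h3, mul_assoc (s' * u), h2, mul_assoc]
      _ = s' * x := by rw [hu]
  exact conK_iff.2 fun x hx => hx.elim (key s s' hs hs' x) fun hx => (key s' s hs' hs x hx).symm

theorem conD_of_rel
    (hτ : ∀ (e : T) (he : IsIdempotentElem e), Nonempty (τ.fiber e he) → classD (τ.fiber e he))
    (s s' : S) (t : T) (hs : τ.rel s t) (hs' : τ.rel s' t) : conD S s s' := by
  have key : ∀ s s' : S, τ.rel s t → τ.rel s' t → ∀ x, (∃ u, x * s * u = x) →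
      x * s = x * s' := by
    rintro s s' hs hs' x ⟨u, hu⟩
    obtain ⟨v, hv⟩ := τ.total u
    obtain ⟨k, l, hkl, hk, hl, hi, hj, -, hx⟩ := τ.exists_isIdempotentElem (τ.mul hv hs)
    rw [hk] at hi
    rw [hl] at hj
    have hf : τ.rel (k * (u * s)) (l * (v * t)) := τ.mul hkl (τ.mul hv hs)
    have hw : τ.rel (k * (u * s')) (l * (v * t)) := τ.mul hkl (τ.mul hv hs')
    have hD := (hτ _ hj ⟨⟨_, hf⟩⟩).2.2 ⟨_, hf⟩ ⟨_, hw⟩ (Subtype.ext hi.eq)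
    replace hD : k * (u * s) * (k * (u * s')) = k * (u * s) := congrArg Subtype.val hD
    have h1 : x * s * (u * s) = x * s := by rw [← mul_assoc, hu]
    have h2 : x * s * k = x * s := hx _ h1
    have h3 : x * s * (k * (u * s)) = x * s := by rw [← mul_assoc, h2, h1]
    calc x * s = x * s * (k * (u * s) * (k * (u * s'))) := by rw [hD, h3]
      _ = x * s * u * s' := by
        rw [← mul_assoc, h3, ← mul_assoc (x * s), h2, mul_assoc (x * s)]
      _ = x * s' := by rw [hu]
  exact conD_iff.2 fun x hx => hx.elim (key s s' hs hs' x) fun hx => (key s' s hs' hs x hx).symm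

theorem conN_of_rel
    (hτ : ∀ (e : T) (he : IsIdempotentElem e), Nonempty (τ.fiber e he) → classN (τ.fiber e he))
    (s s' : S) (t : T) (hs : τ.rel s t) (hs' : τ.rel s' t) : conN S s s' :=
  conN_iff.2
    ⟨conK_of_rel τ (fun e he hne => (classN_iff.1 (hτ e he hne)).2) s s' t hs hs',
      conD_of_rel τ (fun e he hne => (classN_iff.1 (hτ e he hne)).1) s s' t hs hs'⟩

/-- If `s` and `s'` are related to a common element and `x * s * y` is linked to `x` and `y`, then
`x * s' * y` arises from `x * s * y` by inserting an element `f * w * f`, where the idempotent `f`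
and `w` are related to a common idempotent. -/
theorem Links.exists_insertion {x y s s' : S} {t : T} (h : Links x y s) (hs : τ.rel s t)
    (hs' : τ.rel s' t) :
    ∃ (f w c d z : S) (g : T), IsIdempotentElem f ∧ IsIdempotentElem g ∧ τ.rel f g ∧ τ.rel w g ∧
      x * f = x ∧ f * (s * y) = s * y ∧ x * s' * y = x * (f * w * f) * (s * y) ∧
      s * y * c = f ∧ d * x = f ∧ z * (s * y) = y := by
  obtain ⟨⟨a, ha⟩, b, hb⟩ := h
  -- This one element reverses both sides: `s * (b * x)` fixes `x` on the right and `s * y` on the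
  -- left. Its idempotent power is `f`, and `w` is `f` with leading `s` replaced by `s'`. The
  -- witnesses `c` and `d` make `f` R-related to `s * y` and L-related to `x`.
  have hz : b * x = y * a := by
    calc b * x = b * (x * s * y) * a := by rw [mul_assoc, ha]
      _ = y * a := by rw [hb]
  obtain ⟨v, hv⟩ := τ.total (b * x)
  obtain ⟨k, l, hkl, hk, hl, hi, hj, hy, hx⟩ := τ.exists_isIdempotentElem (τ.mul hs hv)
  have hf : τ.rel (s * (b * x) * k) (t * v * l) := τ.mul (τ.mul hs hv) hkl
  have hw : τ.rel (s' * (b * x) * k) (t * v * l) := τ.mul (τ.mul hs' hv) hkl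
  have hzsy : b * x * (s * y) = y := by simpa only [mul_assoc] using hb
  have hxsz : x * (s * (b * x)) = x := by rw [hz]; simpa only [mul_assoc] using ha
  have hszsy : s * (b * x) * (s * y) = s * y := by rw [mul_assoc, hzsy]
  have hxk : x * k = x := hx _ hxsz
  have hky : k * (s * y) = s * y := hy _ hszsy
  have hxf : x * (s * (b * x) * k) = x := by rw [← mul_assoc, hxsz, hxk]
  have hfy : s * (b * x) * k * (s * y) = s * y := by rw [mul_assoc, hky, hszsy]
  refine ⟨s * (b * x) * k, s' * (b * x) * k, a * k, k * s * b, b * x, t * v * l, hi, hj, hf, hw,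
    hxf, hfy, ?_, ?_, ?_, hzsy⟩
  · calc x * s' * y = x * s' * (b * x * (k * (s * y))) := by rw [hky, hzsy]
      _ = x * (s' * (b * x) * k) * (s * y) := by simp only [mul_assoc]
      _ = x * (s * (b * x) * k) * (s' * (b * x) * k) * (s * (b * x) * k * (s * y)) := by
        rw [hxf, hfy]
      _ = _ := by simp only [mul_assoc]
  · rw [hz]
    simp only [mul_assoc]
  · rw [hk]
    simp only [mul_assoc]

theorem conLI_of_rel
    (hτ : ∀ (e : T) (he : IsIdempotentElem e), Nonempty (τ.fiber e he) →
      localClass classI (τ.fiber e he))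
    (s s' : S) (t : T) (hs : τ.rel s t) (hs' : τ.rel s' t) : conLI S s s' := by
  have key : ∀ s s' : S, τ.rel s t → τ.rel s' t → ∀ x y, Links x y s →
      x * s * y = x * s' * y := by
    intro s s' hs hs' x y h
    obtain ⟨f, w, -, -, -, g, hi, hj, hf, hw, hxf, hfy, h1, -, -, -⟩ :=
      h.exists_insertion τ hs hs'
    have hI := ((hτ g hj ⟨⟨f, hf⟩⟩).2.2 ⟨f, hf⟩ (Subtype.ext hi.eq)).2
      ⟨_, ⟨f, hf⟩, rfl⟩ ⟨_, ⟨w, hw⟩, rfl⟩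
    replace hI : f * f * f = f * w * f := congrArg (fun q => q.1.1) hI
    rw [h1, ← hI, hi.eq, hi.eq, hxf, mul_assoc]
  exact conLI_iff.2 fun x y h =>
    h.elim (key s s' hs hs' x y) fun h => (key s' s hs' hs x y h).symm

theorem conLG_of_rel
    (hτ : ∀ (e : T) (he : IsIdempotentElem e), Nonempty (τ.fiber e he) →
      localClass classG (τ.fiber e he))
    (s s' : S) (t : T) (hs : τ.rel s t) (hs' : τ.rel s' t) : conLG S s s' := by
  have key : ∀ s s' : S, τ.rel s t → τ.rel s' t → ∀ x y, Links x y s → Links x y s' := by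
    intro s s' hs hs' x y h
    obtain ⟨f, w, c, d, z, g, hi, hj, hf, hw, hxf, hfy, h1, hc, hd, hz⟩ :=
      h.exists_insertion τ hs hs'
    obtain ⟨-, o, ho⟩ := (hτ g hj ⟨⟨f, hf⟩⟩).2.2 ⟨f, hf⟩ (Subtype.ext hi.eq)
    -- The identity of the corner group is `f`, so `f * w * f` has an inverse relative to `f`; this
    -- inverse cancels the insertion on either side.
    have hof : o.1.1 = f := by
      have h2 := (ho ⟨⟨f, hf⟩, ⟨f, hf⟩, Subtype.ext (by
        change f = f * f * f
        rw [hi.eq, hi.eq])⟩).1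
      have h3 := (mem_corner_iff (e := (⟨f, hf⟩ : τ.fiber g hj)) (Subtype.ext hi.eq)).1 o.2
      exact (congrArg Subtype.val h3.2).symm.trans (congrArg (fun q => q.1.1) h2)
    obtain ⟨-, -, q, hq, hq'⟩ := ho ⟨_, ⟨w, hw⟩, rfl⟩
    replace hq : f * w * f * q.1.1 = f := (congrArg (fun q => q.1.1) hq).trans hof
    replace hq' : q.1.1 * (f * w * f) = f := (congrArg (fun q => q.1.1) hq').trans hof
    generalize q.1.1 = r at hq hq'
    have hff : f * w * f * f = f * w * f := by rw [mul_assoc, hi.eq]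
    have hff' : f * (f * w * f) = f * w * f := by rw [← mul_assoc, ← mul_assoc, hi.eq]
    refine ⟨⟨c * r, ?_⟩, z * r * d, ?_⟩
    · calc x * s' * y * (c * r) = x * (f * w * f) * (s * y * c) * r := by
            rw [h1]; simp only [mul_assoc]
        _ = x * (f * w * f * f * r) := by rw [hc]; simp only [mul_assoc]
        _ = x := by rw [hff, hq, hxf]
    · calc z * r * d * (x * s' * y) = z * r * (d * x * (f * w * f)) * (s * y) := by
            rw [h1]; simp only [mul_assoc]
        _ = z * (r * (f * w * f) * (s * y)) := by rw [hd, hff']; simp only [mul_assoc]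
        _ = y := by rw [hq', hfy, hz]
  exact conLG_iff.2 fun x y => ⟨key s s' hs hs' x y, key s' s hs' hs x y⟩

end Relations

end FOMul

theorem mainTheorem3 (V : FOMul.SemigroupClass.{u}) (hV : FOMul.IsPseudovariety V)
    (hdef : FOMul.SemigroupClass.FODefinable V) :
    FOMul.SemigroupClass.FODefinable (FOMul.malcev FOMul.classK V) ∧
    FOMul.SemigroupClass.FODefinable (FOMul.malcev FOMul.classD V) ∧
    FOMul.SemigroupClass.FODefinable (FOMul.malcev FOMul.classN V) ∧
    FOMul.SemigroupClass.FODefinable (FOMul.malcev (FOMul.localClass FOMul.classI) V) ∧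
    FOMul.SemigroupClass.FODefinable (FOMul.malcev (FOMul.localClass FOMul.classG) V) := by
  refine ⟨hdef.of_quotient FOMul.conK FOMul.defRel_conK ?_,
    hdef.of_quotient FOMul.conD FOMul.defRel_conD ?_,
    hdef.of_quotient FOMul.conN FOMul.defRel_conN ?_,
    hdef.of_quotient FOMul.conLI FOMul.defRel_conLI ?_,
    hdef.of_quotient FOMul.conLG FOMul.defRel_conLG ?_⟩
  · exact FOMul.malcev_iff_quotient hV FOMul.conK (fun _ => FOMul.classK_of_conK)
      fun _ _ => FOMul.conK_of_rel
  · exact FOMul.malcev_iff_quotient hV FOMul.conD (fun _ => FOMul.classD_of_conD)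
      fun _ _ => FOMul.conD_of_rel
  · exact FOMul.malcev_iff_quotient hV FOMul.conN (fun _ => FOMul.classN_of_conN)
      fun _ _ => FOMul.conN_of_rel
  · exact FOMul.malcev_iff_quotient hV FOMul.conLI (fun _ => FOMul.localClassI_of_conLI)
      fun _ _ => FOMul.conLI_of_rel
  · exact FOMul.malcev_iff_quotient hV FOMul.conLG (fun _ => FOMul.localClassG_of_conLG)
      fun _ _ => FOMul.conLG_of_rel
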